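/- Let $\mathcal H$ be a complex Hilbert space with an orthonormal basis $(e_n)_{n\in\mathbb Z}$, let $(\omega_n)_{n\in\mathbb Z}$ be a bounded sequence of positive numbers, and let $S$ be the bilateral weighted shift, i.e. the bounded linear operator on $\mathcal H$ with $Se_n=\omega_n e_{n+1}$ for all $n\in\mathbb Z$. Put $\beta_n=\omega_0\cdots\omega_{n-1}$ for $n>0$, $\beta_0=1$, $\beta_n=1/(\omega_n\cdots\omega_{-1})$ for $n<0$, and $$r^-(S)=\lim_{n\to\infty}\Big[\sup_{k>0}\tfrac{\beta_{-k}}{\beta_{-n-k}}\Big]^{1/n},\quad r^+(S)=\lim_{n\to\infty}\Big[\sup_{k\ge0}\tfrac{\beta_{n+k}}{\beta_k}\Big]^{1/n},$$ $$r_1^-(S)=\lim_{n\to\infty}\Big[\inf_{k>0}\tfrac{\beta_{-k}}{\beta_{-n-k}}\Big]^{1/n},\quad r_1^+(S)=\lim_{n\to\infty}\Big[\inf_{k\ge0}\tfrac{\beta_{n+k}}{\beta_k}\Big]^{1/n},$$ $$r_2^-(S)=\liminf_{n\to\infty}\Big[\tfrac1{\beta_{-n}}\Big]^{1/n},\quad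 r_2^+(S)=\liminf_{n\to\infty}\beta_n^{1/n},\quad r_3^-(S)=\limsup_{n\to\infty}\Big[\tfrac1{\beta_{-n}}\Big]^{1/n},\quad r_3^+(S)=\limsup_{n\to\infty}\beta_n^{1/n}.$$ Let $r(\cdot)$ denote the spectral radius and $q(S)=\min\{|\lambda|:\lambda\in\sigma(S)\}$. For an open set $U\subset\mathbb C$ let $\mathcal O(U,\mathcal H)$ be the space of analytic $\mathcal H$-valued functions on $U$ with the topology of uniform convergence on compact subsets of $U$, and for a bounded operator $T$ on $\mathcal H$ let $T_U$ be the map on $\mathcal O(U,\mathcal H)$ given by $(T_Uf)(\lambda)=(T-\lambda)f(\lambda)$. The operator $T$ possesses Bishop's property $(\beta)$ if $T_U$ is injective with closed range for every open $U\subset\mathbb C$; it possesses $(\beta)$ at $\lambda_0\in\mathbb C$ if there is an open neighbourhood $V$ of $\lambda_0$ such that $T_U$ is injective with closed range for every open $U\subset V$. Let $\sigma_\beta(T)$ be the set of all $\lambda\in\mathbb C$ at which $T$ fails to possess $(\beta)$. **Theorem.** Assume that $$q(S)=r_1^-(S)=r_2^-(S)=r_3^-(S)=r^-(S)\quad\text{and}\quad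 r_1^+(S)=r_2^+(S)=r_3^+(S)=r^+(S)=r(S).$$ (a) If $S$ is not invertible, then either $S$ possesses Bishop's property $(\beta)$ or $\sigma_\beta(S)=\{\lambda\in\mathbb C:|\lambda|=r(S)\}$. (b) If $S$ is invertible, then either $S$ possesses Bishop's property $(\beta)$ or $\sigma_\beta(S)$ equals one of the circles $\{\lambda\in\mathbb C:|\lambda|=1/r(S^{-1})\}$ and $\{\lambda\in\mathbb C:|\lambda|=r(S)\}$, or the union of both of them. -/

import Mathlib

open Filter Topology

namespace WeightedShift

noncomputable section

/-! ### Bishop's property (β) -/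

section Bishop

variable {H : Type*} [NormedAddCommGroup H] [InnerProductSpace ℂ H]

/-- The space `O(U, H)` of analytic `H`-valued functions on `U ⊆ ℂ`, as a subspace of the space
`C(U, H)` of continuous functions. It carries the induced topology; the topology of `C(U, H)` is
the compact-open one, that is, the topology of uniform convergence on compact subsets of `U`. -/
def holo (U : Set ℂ) : Submodule ℂ C(U, H) where
  carrier := {f | ∃ F : ℂ → H, AnalyticOnNhd ℂ F U ∧ ∀ z : U, f z = F z}
  add_mem' := by
    rintro f g ⟨F, hF, hf⟩ ⟨G, hG, hg⟩
    exact ⟨F + G, hF.add hG, fun z => by simp [hf, hg]⟩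
  zero_mem' := ⟨0, fun _ _ => analyticAt_const, fun _ => rfl⟩
  smul_mem' := by
    rintro c f ⟨F, hF, hf⟩
    exact ⟨c • F, fun z hz => (hF z hz).const_smul, fun z => by simp [hf]⟩

/-- The map `T_U` on `O(U, H)`, given by `(T_U f)(z) = (T - z) f(z)`. -/
def bishopMap (T : H →L[ℂ] H) (U : Set ℂ) : holo (H := H) U →ₗ[ℂ] holo (H := H) U where
  toFun f := ⟨⟨fun z => T (f.1 z) - (z : ℂ) • f.1 z, by fun_prop⟩, by
    obtain ⟨F, hF, hf⟩ := f.2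
    refine ⟨fun z => T (F z) - z • F z, fun z hz => ?_, fun z => by simp [hf]⟩
    exact ((T.analyticAt _).comp (hF z hz)).sub (analyticAt_id.smul (hF z hz))⟩
  map_add' f g := by
    ext z
    simp only [Submodule.coe_add, ContinuousMap.add_apply, ContinuousMap.coe_mk, map_add, smul_add]
    abel
  map_smul' c f := by
    ext z
    simp only [Submodule.coe_smul, ContinuousMap.smul_apply, ContinuousMap.coe_mk, map_smul,
      RingHom.id_apply, smul_sub, smul_comm c]

/-- Bishop's property (β): for every open `U ⊆ ℂ`, the map `T_U` is injective and has closed range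
in `O(U, H)`. -/
def HasBishop (T : H →L[ℂ] H) : Prop :=
  ∀ U : Set ℂ, IsOpen U →
    Function.Injective (bishopMap T U) ∧ IsClosed (Set.range (bishopMap T U))

/-- Bishop's property (β) at the point `z₀`. -/
def HasBishopAt (T : H →L[ℂ] H) (z₀ : ℂ) : Prop :=
  ∃ V : Set ℂ, IsOpen V ∧ z₀ ∈ V ∧ ∀ U : Set ℂ, IsOpen U → U ⊆ V →
    Function.Injective (bishopMap T U) ∧ IsClosed (Set.range (bishopMap T U))

/-- `σ_β(T)`: the set of points at which `T` fails to possess Bishop's property (β). -/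
def sigmaBeta (T : H →L[ℂ] H) : Set ℂ := {z | ¬ HasBishopAt T z}

/-- The spectral radius `r(T)` as a real number. -/
def specRadius (T : H →L[ℂ] H) : ℝ := (spectralRadius ℂ T).toReal

/-- `q(T) = min {|z| : z ∈ σ(T)}`. -/
def minModulus (T : H →L[ℂ] H) : ℝ := sInf ((fun z : ℂ => ‖z‖) '' spectrum ℂ T)

end Bishop

/-! ### Bilateral weighted shifts and their radii -/

/-- `S` is the bilateral weighted shift with positive weights `ω` along the orthonormal basis `e`.
(The weights are bounded because `S` is, see `IsBilateralShift.bddAbove`.) -/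
structure IsBilateralShift {H : Type*} [NormedAddCommGroup H] [InnerProductSpace ℂ H]
    (e : HilbertBasis ℤ ℂ H) (ω : ℤ → ℝ) (S : H →L[ℂ] H) : Prop where
  pos : ∀ n, 0 < ω n
  apply_basis : ∀ n, S (e n) = (ω n : ℂ) • e (n + 1)

/-- `β_n = ω_0 ⋯ ω_{n-1}` for `n ≥ 0` (so `β_0 = 1`), and `β_n = 1 / (ω_n ⋯ ω_{-1})` for
`n < 0`. -/
def beta (ω : ℤ → ℝ) (n : ℤ) : ℝ :=
  if 0 ≤ n then ∏ i ∈ Finset.Ico 0 n, ω i else 1 / ∏ i ∈ Finset.Ico n 0, ω i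

/-- `r^-(S) = lim_n [sup_{k>0} β_{-k} / β_{-n-k}]^{1/n}`; here `k > 0` is written as `k + 1`. -/
def rMinus (ω : ℤ → ℝ) : ℝ :=
  limUnder atTop fun n : ℕ =>
    (⨆ k : ℕ, beta ω (-(k + 1)) / beta ω (-n - (k + 1))) ^ (1 / (n : ℝ))

/-- `r^+(S) = lim_n [sup_{k≥0} β_{n+k} / β_k]^{1/n}`. -/
def rPlus (ω : ℤ → ℝ) : ℝ :=
  limUnder atTop fun n : ℕ => (⨆ k : ℕ, beta ω (n + k) / beta ω k) ^ (1 / (n : ℝ))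

/-- `r_1^-(S) = lim_n [inf_{k>0} β_{-k} / β_{-n-k}]^{1/n}`; here `k > 0` is written as `k + 1`. -/
def rMinus₁ (ω : ℤ → ℝ) : ℝ :=
  limUnder atTop fun n : ℕ =>
    (⨅ k : ℕ, beta ω (-(k + 1)) / beta ω (-n - (k + 1))) ^ (1 / (n : ℝ))

/-- `r_1^+(S) = lim_n [inf_{k≥0} β_{n+k} / β_k]^{1/n}`. -/
def rPlus₁ (ω : ℤ → ℝ) : ℝ :=
  limUnder atTop fun n : ℕ => (⨅ k : ℕ, beta ω (n + k) / beta ω k) ^ (1 / (n : ℝ))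

/-- `r_2^-(S) = liminf_n [1 / β_{-n}]^{1/n}`. -/
def rMinus₂ (ω : ℤ → ℝ) : ℝ :=
  liminf (fun n : ℕ => (1 / beta ω (-n)) ^ (1 / (n : ℝ))) atTop

/-- `r_2^+(S) = liminf_n [β_n]^{1/n}`. -/
def rPlus₂ (ω : ℤ → ℝ) : ℝ :=
  liminf (fun n : ℕ => (beta ω n) ^ (1 / (n : ℝ))) atTop

/-- `r_3^-(S) = limsup_n [1 / β_{-n}]^{1/n}`. -/
def rMinus₃ (ω : ℤ → ℝ) : ℝ :=
  limsup (fun n : ℕ => (1 / beta ω (-n)) ^ (1 / (n : ℝ))) atTop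

/-- `r_3^+(S) = limsup_n [β_n]^{1/n}`. -/
def rPlus₃ (ω : ℤ → ℝ) : ℝ :=
  limsup (fun n : ℕ => (beta ω n) ^ (1 / (n : ℝ))) atTop

/-! ### The limits in the definitions of the radii exist -/

theorem IsBilateralShift.bddAbove {H : Type*} [NormedAddCommGroup H] [InnerProductSpace ℂ H]
    {e : HilbertBasis ℤ ℂ H} {ω : ℤ → ℝ} {S : H →L[ℂ] H} (hS : IsBilateralShift e ω S) :
    BddAbove (Set.range ω) := by
  refine ⟨‖S‖, ?_⟩
  rintro _ ⟨n, rfl⟩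
  have h := S.le_opNorm (e n)
  rw [hS.apply_basis, norm_smul, e.orthonormal.1, e.orthonormal.1] at h
  simpa [abs_of_pos (hS.pos n)] using h

theorem exists_tendsto_of_submul {v : ℕ → ℝ} (hv : ∀ n, 0 < v n)
    (h : ∀ m n, v (m + n) ≤ v m * v n) :
    ∃ L, Tendsto (fun n : ℕ => v n ^ (1 / (n : ℝ))) atTop (𝓝 L) := by
  have hs : Subadditive fun n => Real.log (v n) := fun m n => by
    simp only
    rw [← Real.log_mul (hv m).ne' (hv n).ne']
    exact Real.log_le_log (hv _) (h m n)
  have hrw : ∀ n : ℕ, v n ^ (1 / (n : ℝ)) = Real.exp (Real.log (v n) / n) := fun n => by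
    rw [Real.rpow_def_of_pos (hv n), mul_one_div]
  have hb : BddBelow ((fun n : ℕ => v n ^ (1 / (n : ℝ))) '' Set.Ici 1) :=
    ⟨0, by rintro _ ⟨n, -, rfl⟩; exact Real.rpow_nonneg (hv n).le _⟩
  refine ⟨sInf ((fun n : ℕ => v n ^ (1 / (n : ℝ))) '' Set.Ici 1), tendsto_order.2 ⟨fun l hl => ?_,
    fun L hL => ?_⟩⟩
  · exact eventually_atTop.2 ⟨1, fun n hn => hl.trans_le (csInf_le hb ⟨n, hn, rfl⟩)⟩
  · obtain ⟨_, ⟨n, hn, rfl⟩, hx⟩ := exists_lt_of_csInf_lt (by simp) hL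
    have hL0 : 0 < L := (Real.rpow_pos_of_pos (hv n) _).trans hx
    simp only [hrw] at hx ⊢
    rw [← Real.lt_log_iff_exp_lt hL0] at hx
    refine (hs.eventually_div_lt_of_div_lt (Nat.one_le_iff_ne_zero.1 hn) hx).mono fun p hp => ?_
    exact (Real.lt_log_iff_exp_lt hL0).1 hp

theorem exists_tendsto_iSup {w : ℕ → ℝ} (hw : ∀ n, 0 < w n) (hb : BddAbove (Set.range w)) :
    ∃ L, Tendsto (fun n : ℕ => (⨆ k : ℕ, ∏ i ∈ Finset.range n, w (k + i)) ^ (1 / (n : ℝ)))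
      atTop (𝓝 L) := by
  obtain ⟨C, hC⟩ := hb
  have hC' : ∀ n, w n ≤ C := fun n => hC ⟨n, rfl⟩
  have hbd : ∀ n, BddAbove (Set.range fun k : ℕ => ∏ i ∈ Finset.range n, w (k + i)) := fun n => by
    refine ⟨C ^ n, ?_⟩
    rintro _ ⟨k, rfl⟩
    simpa using Finset.prod_le_prod (s := Finset.range n) (fun i _ => (hw (k + i)).le)
      (fun i _ => hC' (k + i))
  have hpos : ∀ n k, 0 < ∏ i ∈ Finset.range n, w (k + i) := fun n k =>
    Finset.prod_pos fun i _ => hw _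
  refine exists_tendsto_of_submul (fun n => (hpos n 0).trans_le (le_ciSup (hbd n) 0))
    fun m n => ciSup_le fun k => ?_
  rw [Finset.prod_range_add]
  refine mul_le_mul (le_ciSup (hbd m) k) ?_ (Finset.prod_pos fun i _ => hw _).le
    ((hpos m 0).trans_le (le_ciSup (hbd m) 0)).le
  simpa only [add_assoc] using le_ciSup (hbd n) (k + m)

theorem exists_tendsto_iInf {w : ℕ → ℝ} (hw : ∀ n, 0 < w n) (hb : BddAbove (Set.range w)) :
    ∃ L, Tendsto (fun n : ℕ => (⨅ k : ℕ, ∏ i ∈ Finset.range n, w (k + i)) ^ (1 / (n : ℝ)))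
      atTop (𝓝 L) := by
  obtain ⟨C, hC⟩ := hb
  have hC' : ∀ n, w n ≤ C := fun n => hC ⟨n, rfl⟩
  have hC0 : 0 < C := (hw 0).trans_le (hC' 0)
  have hpos : ∀ n k, 0 < ∏ i ∈ Finset.range n, w (k + i) := fun n k =>
    Finset.prod_pos fun i _ => hw _
  have hle : ∀ n k, ∏ i ∈ Finset.range n, w (k + i) ≤ C ^ n := fun n k => by
    simpa using Finset.prod_le_prod (s := Finset.range n) (fun i _ => (hw (k + i)).le)
      (fun i _ => hC' (k + i))
  have hbd : ∀ n, BddBelow (Set.range fun k : ℕ => ∏ i ∈ Finset.range n, w (k + i)) := fun n =>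
    ⟨0, by rintro _ ⟨k, rfl⟩; exact (hpos n k).le⟩
  by_cases hc : ∃ c, 0 < c ∧ ∀ n, c ≤ w n
  · obtain ⟨c, hc, hcw⟩ := hc
    have hI : ∀ n, 0 < ⨅ k : ℕ, ∏ i ∈ Finset.range n, w (k + i) := fun n =>
      (pow_pos hc n).trans_le <| le_ciInf fun k => by
        simpa using Finset.prod_le_prod (s := Finset.range n) (fun i _ => hc.le)
          (fun i _ => hcw (k + i))
    obtain ⟨L, hL⟩ := exists_tendsto_of_submul
      (v := fun n => (⨅ k : ℕ, ∏ i ∈ Finset.range n, w (k + i))⁻¹)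
      (fun n => inv_pos.2 (hI n)) fun m n => by
        rw [← mul_inv]
        refine inv_anti₀ (mul_pos (hI m) (hI n)) (le_ciInf fun k => ?_)
        rw [Finset.prod_range_add]
        refine mul_le_mul (ciInf_le (hbd m) k) ?_ (hI n).le (hpos m k).le
        simpa only [add_assoc] using ciInf_le (hbd n) (k + m)
    have hL0 : L ≠ 0 := by
      refine ((inv_pos.2 hC0).trans_le (ge_of_tendsto hL ?_)).ne'
      filter_upwards [eventually_ge_atTop 1] with n hn
      have hn' : (n : ℝ) ≠ 0 := by positivity
      rw [Real.inv_rpow (hI n).le]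
      refine inv_anti₀ (Real.rpow_pos_of_pos (hI n) _) ?_
      calc _ ≤ (C ^ n) ^ (1 / (n : ℝ)) :=
            Real.rpow_le_rpow (hI n).le ((ciInf_le (hbd n) 0).trans (hle n 0)) (by positivity)
        _ = C := by
            rw [← Real.rpow_natCast, ← Real.rpow_mul hC0.le, mul_one_div_cancel hn', Real.rpow_one]
    refine ⟨L⁻¹, (hL.inv₀ hL0).congr fun n => ?_⟩
    rw [Real.inv_rpow (hI n).le, inv_inv]
  · push Not at hc
    refine ⟨0, tendsto_const_nhds.congr' ?_⟩
    filter_upwards [eventually_ge_atTop 1] with n hn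
    have hz : (⨅ k : ℕ, ∏ i ∈ Finset.range n, w (k + i)) = 0 := by
      refine le_antisymm (le_of_forall_pos_le_add fun ε hε => ?_)
        (le_ciInf fun k => (hpos n k).le)
      obtain ⟨k, hk⟩ := hc (ε / C ^ (n - 1)) (by positivity)
      refine (ciInf_le (hbd n) k).trans ?_
      obtain ⟨m, rfl⟩ := Nat.exists_eq_add_of_le' hn
      rw [Finset.prod_range_succ', zero_add]
      have h1 : ∏ i ∈ Finset.range m, w (k + (i + 1)) ≤ C ^ m := by
        simpa using Finset.prod_le_prod (s := Finset.range m) (fun i _ => (hw (k + (i + 1))).le)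
          (fun i _ => hC' (k + (i + 1)))
      calc _ ≤ C ^ m * (ε / C ^ m) := by
            refine mul_le_mul h1 ?_ (hw _).le (by positivity)
            simpa using hk.le
        _ = ε := by field_simp
    rw [hz, Real.zero_rpow]
    positivity

theorem beta_pos {ω : ℤ → ℝ} (hω : ∀ n, 0 < ω n) (n : ℤ) : 0 < beta ω n := by
  unfold beta
  split_ifs
  · exact Finset.prod_pos fun i _ => hω i
  · exact one_div_pos.2 (Finset.prod_pos fun i _ => hω i)

theorem beta_succ {ω : ℤ → ℝ} (hω : ∀ n, 0 < ω n) (n : ℤ) :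
    beta ω (n + 1) = beta ω n * ω n := by
  unfold beta
  rcases lt_trichotomy n (-1) with h | h | h
  · have h1 : Finset.Ico n 0 = insert n (Finset.Ico (n + 1) 0) := by ext; simp; lia
    rw [if_neg (by lia), if_neg (by lia), h1, Finset.prod_insert (by simp)]
    have := (hω n).ne'
    have : ∏ i ∈ Finset.Ico (n + 1) 0, ω i ≠ 0 := (Finset.prod_pos fun i _ => hω i).ne'
    field_simp
  · subst h
    have h1 : Finset.Ico (-1 : ℤ) 0 = {-1} := rfl
    have := (hω (-1)).ne'
    simp [h1, this]
  · rw [if_pos (by lia), if_pos (by lia)]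
    have : Finset.Ico 0 (n + 1) = insert n (Finset.Ico 0 n) := by ext; simp; lia
    rw [this, Finset.prod_insert (by simp), mul_comm]

theorem beta_add_div {ω : ℤ → ℝ} (hω : ∀ n, 0 < ω n) (m : ℤ) (n : ℕ) :
    beta ω (m + n) / beta ω m = ∏ i ∈ Finset.range n, ω (m + i) := by
  rw [div_eq_iff (beta_pos hω m).ne']
  induction n with
  | zero => simp
  | succ n ih =>
    rw [Nat.cast_succ, ← add_assoc, beta_succ hω, ih, Finset.prod_range_succ]
    ring

theorem beta_neg_div {ω : ℤ → ℝ} (hω : ∀ n, 0 < ω n) (n k : ℕ) :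
    beta ω (-(k + 1)) / beta ω (-n - (k + 1)) =
      ∏ i ∈ Finset.range n, ω (-((k + i : ℕ) : ℤ) - 2) := by
  have h := beta_add_div hω (-n - (k + 1)) n
  rw [show (-n - (k + 1) + n : ℤ) = -(k + 1) by ring] at h
  rw [h, ← Finset.prod_range_reflect]
  refine Finset.prod_congr rfl fun i hi => congrArg ω ?_
  have := Finset.mem_range.1 hi
  lia

section

variable {H : Type*} [NormedAddCommGroup H] [InnerProductSpace ℂ H]
  {e : HilbertBasis ℤ ℂ H} {ω : ℤ → ℝ} {S : H →L[ℂ] H}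

theorem IsBilateralShift.tendsto_rPlus (hS : IsBilateralShift e ω S) :
    Tendsto (fun n : ℕ => (⨆ k : ℕ, beta ω (n + k) / beta ω k) ^ (1 / (n : ℝ))) atTop
      (𝓝 (rPlus ω)) := by
  refine tendsto_nhds_limUnder ?_
  have h : ∀ n k : ℕ, beta ω (n + k) / beta ω k = ∏ i ∈ Finset.range n, ω ((k + i : ℕ) : ℤ) :=
    fun n k => by rw [add_comm, beta_add_div hS.pos]; simp
  simp only [h]
  exact exists_tendsto_iSup (w := fun n : ℕ => ω n) (fun n => hS.pos n)
    (hS.bddAbove.mono (Set.range_comp_subset_range _ _))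

theorem IsBilateralShift.tendsto_rPlus₁ (hS : IsBilateralShift e ω S) :
    Tendsto (fun n : ℕ => (⨅ k : ℕ, beta ω (n + k) / beta ω k) ^ (1 / (n : ℝ))) atTop
      (𝓝 (rPlus₁ ω)) := by
  refine tendsto_nhds_limUnder ?_
  have h : ∀ n k : ℕ, beta ω (n + k) / beta ω k = ∏ i ∈ Finset.range n, ω ((k + i : ℕ) : ℤ) :=
    fun n k => by rw [add_comm, beta_add_div hS.pos]; simp
  simp only [h]
  exact exists_tendsto_iInf (w := fun n : ℕ => ω n) (fun n => hS.pos n)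
    (hS.bddAbove.mono (Set.range_comp_subset_range _ _))

theorem IsBilateralShift.tendsto_rMinus (hS : IsBilateralShift e ω S) :
    Tendsto (fun n : ℕ =>
      (⨆ k : ℕ, beta ω (-(k + 1)) / beta ω (-n - (k + 1))) ^ (1 / (n : ℝ))) atTop
      (𝓝 (rMinus ω)) := by
  refine tendsto_nhds_limUnder ?_
  simp only [beta_neg_div hS.pos]
  exact exists_tendsto_iSup (w := fun n : ℕ => ω (-(n : ℤ) - 2)) (fun n => hS.pos _)
    (hS.bddAbove.mono (Set.range_comp_subset_range _ _))

theorem IsBilateralShift.tendsto_rMinus₁ (hS : IsBilateralShift e ω S) :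
    Tendsto (fun n : ℕ =>
      (⨅ k : ℕ, beta ω (-(k + 1)) / beta ω (-n - (k + 1))) ^ (1 / (n : ℝ))) atTop
      (𝓝 (rMinus₁ ω)) := by
  refine tendsto_nhds_limUnder ?_
  simp only [beta_neg_div hS.pos]
  exact exists_tendsto_iInf (w := fun n : ℕ => ω (-(n : ℤ) - 2)) (fun n => hS.pos _)
    (hS.bddAbove.mono (Set.range_comp_subset_range _ _))

end

end

end WeightedShift

/-!
Let `σ_ap(T)` be the approximate point spectrum of `T`. Every point of `σ_β(T)` is an accumulation
point of `σ_ap(T)`: a point that is not has arbitrarily small circles around it on which `T - w` is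
bounded below uniformly in `w`, and by the maximum principle uniform convergence of `T_U f_i` on
such a circle forces uniform convergence of `f_i` on the disc it bounds.

For the shift, `Sⁿ` maps the closed span of the `e m` with `0 ≤ m` to itself. On that subspace
`‖Sⁿ x‖ ≥ bⁿ ‖x‖` for any `b < r₁⁺` and large `n`, while the operator induced by `Sⁿ` on the
quotient has norm at most `aⁿ` for any `a > r⁻`, so that `σ_ap(S)` does not meet the annulus
`r⁻ < |z| < r₁⁺`. Under the hypotheses this annulus is `q(S) < |z| < r(S)`, and `σ_ap(S)` lies in
its two bounding circles. Since `S` is unitarily equivalent to `c S` whenever `|c| = 1`, the set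
`σ_β(S)` is rotation invariant, hence empty or a union of some of these circles. If `S` is not
invertible then `q(S) = 0`, and the degenerate circle `{0}` has no accumulation points.
-/

open Filter Topology
open scoped NNReal InnerProductSpace

namespace WeightedShift

section ApproxPointSpectrum

variable {𝕜 E F G : Type*} [NontriviallyNormedField 𝕜] [NormedAddCommGroup E] [NormedSpace 𝕜 E]
  [NormedAddCommGroup F] [NormedSpace 𝕜 F] [NormedAddCommGroup G] [NormedSpace 𝕜 G]

theorem exists_antilipschitzWith_of_forall_norm_le {A : E →L[𝕜] F} {K : ℝ}
    (h : ∀ x, ‖x‖ ≤ K * ‖A x‖) : ∃ C, AntilipschitzWith C A :=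
  ⟨K.toNNReal, A.antilipschitz_of_bound fun x => (h x).trans <| by
    gcongr; exact Real.le_coe_toNNReal K⟩

theorem exists_antilipschitzWith_of_comp {B : F →L[𝕜] G} {A : E →L[𝕜] F}
    (h : ∃ K, AntilipschitzWith K (B.comp A)) : ∃ K, AntilipschitzWith K A := by
  obtain ⟨K, hK⟩ := h
  refine exists_antilipschitzWith_of_forall_norm_le (K := K * ‖B‖) fun x => ?_
  calc ‖x‖ ≤ K * ‖B (A x)‖ := (B.comp A).bound_of_antilipschitz hK x
    _ ≤ K * (‖B‖ * ‖A x‖) := by gcongr; exact B.le_opNorm _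
    _ = K * ‖B‖ * ‖A x‖ := (mul_assoc _ _ _).symm

theorem eventually_antilipschitzWith {A : E →L[𝕜] F} {K : ℝ≥0} (hA : AntilipschitzWith K A) :
    ∀ᶠ B : E →L[𝕜] F in 𝓝 A, AntilipschitzWith (2 * K) B := by
  have hsmall : ∀ᶠ B : E →L[𝕜] F in 𝓝 A, K * ‖A - B‖ < 1 / 2 := by
    have : Continuous fun B : E →L[𝕜] F => K * ‖A - B‖ := by fun_prop
    exact this.continuousAt.eventually_lt_const (by simp)
  filter_upwards [hsmall] with B hB
  refine B.antilipschitz_of_bound fun x => ?_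
  have : ‖x‖ ≤ K * ‖B x‖ + 1 / 2 * ‖x‖ := calc
    ‖x‖ ≤ K * ‖B x + (A - B) x‖ := by simpa using A.bound_of_antilipschitz hA x
    _ ≤ K * (‖B x‖ + ‖A - B‖ * ‖x‖) := by
      gcongr; exact norm_add_le_of_le le_rfl ((A - B).le_opNorm x)
    _ = K * ‖B x‖ + K * ‖A - B‖ * ‖x‖ := by ring
    _ ≤ K * ‖B x‖ + 1 / 2 * ‖x‖ := by gcongr
  push_cast
  linarith

theorem exists_forall_antilipschitzWith_of_isCompact {s : Set (E →L[𝕜] F)} (hs : IsCompact s)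
    (h : ∀ A ∈ s, ∃ K, AntilipschitzWith K A) : ∃ K, ∀ A ∈ s, AntilipschitzWith K A := by
  refine hs.induction_on (p := fun s => ∃ K, ∀ A ∈ s, AntilipschitzWith K A) ⟨0, by simp⟩
    (fun s t hst ⟨K, hK⟩ => ⟨K, fun A hA => hK A (hst hA)⟩) ?_ fun A hA => ?_
  · rintro s t ⟨K, hK⟩ ⟨L, hL⟩
    refine ⟨max K L, ?_⟩
    rintro A (hA | hA)
    · exact fun x y => (hK A hA x y).trans (by gcongr; exact le_max_left K L)
    · exact fun x y => (hL A hA x y).trans (by gcongr; exact le_max_right K L)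
  · obtain ⟨K, hK⟩ := h A hA
    exact ⟨_, mem_nhdsWithin_of_mem_nhds (eventually_antilipschitzWith hK), 2 * K, fun _ h => h⟩

theorem exists_antilipschitzWith_of_isIdempotentElem {P A : E →L[𝕜] E} (hP : IsIdempotentElem P)
    {K₁ K₂ : ℝ} (hrange : ∀ x, ‖P x‖ ≤ K₁ * ‖A x‖) (hker : ∀ x, P x = 0 → ‖x‖ ≤ K₂ * ‖A x‖) :
    ∃ K, AntilipschitzWith K A := by
  refine exists_antilipschitzWith_of_forall_norm_le (K := K₁ + |K₂| * (1 + ‖A‖ * K₁)) fun x => ?_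
  have hPP : P (x - P x) = 0 := by
    rw [map_sub, sub_eq_zero]; exact (congr($(hP.eq) x)).symm
  have hsub : ‖x - P x‖ ≤ |K₂| * (1 + ‖A‖ * K₁) * ‖A x‖ := calc
    ‖x - P x‖ ≤ |K₂| * ‖A x - A (P x)‖ := by
      rw [← map_sub]
      exact (hker _ hPP).trans (by gcongr; exact le_abs_self K₂)
    _ ≤ |K₂| * (‖A x‖ + ‖A‖ * (K₁ * ‖A x‖)) := by
      gcongr
      exact norm_sub_le_of_le le_rfl ((A.le_opNorm _).trans (by gcongr; exact hrange x))
    _ = |K₂| * (1 + ‖A‖ * K₁) * ‖A x‖ := by ring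
  calc ‖x‖ = ‖P x + (x - P x)‖ := by rw [add_sub_cancel]
    _ ≤ K₁ * ‖A x‖ + |K₂| * (1 + ‖A‖ * K₁) * ‖A x‖ := norm_add_le_of_le (hrange x) hsub
    _ = (K₁ + |K₂| * (1 + ‖A‖ * K₁)) * ‖A x‖ := by ring

/-- The approximate point spectrum of `T`, the set of scalars `z` for which `T - z` is not bounded
below; being bounded below is expressed by `AntilipschitzWith`. -/
def approxPointSpectrum (T : E →L[𝕜] E) : Set 𝕜 :=
  {z | ¬ ∃ K, AntilipschitzWith K (T - z • 1 : E →L[𝕜] E)}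

theorem notMem_approxPointSpectrum {T : E →L[𝕜] E} {z : 𝕜} :
    z ∉ approxPointSpectrum T ↔ ∃ K, AntilipschitzWith K (T - z • 1 : E →L[𝕜] E) :=
  not_not

theorem approxPointSpectrum_subset_spectrum (T : E →L[𝕜] E) :
    approxPointSpectrum T ⊆ spectrum 𝕜 T := by
  intro z hz hu
  have hunit : IsUnit (T - z • 1) := by
    rw [← IsUnit.neg_iff, neg_sub, ← Algebra.algebraMap_eq_smul_one]
    exact hu
  refine hz (exists_antilipschitzWith_of_comp (B := Ring.inverse (T - z • 1)) ⟨1, ?_⟩)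
  rw [show (Ring.inverse (T - z • 1)).comp (T - z • 1) = 1 from Ring.inverse_mul_cancel _ hunit]
  exact AntilipschitzWith.id

theorem pow_mem_approxPointSpectrum_pow {T : E →L[𝕜] E} {z : 𝕜} (hz : z ∈ approxPointSpectrum T)
    (n : ℕ) : z ^ n ∈ approxPointSpectrum (T ^ n) := by
  have hfactor := ((Commute.one_right T).smul_right z).geom_sum₂_mul n
  rw [smul_pow, one_pow] at hfactor
  exact fun h => hz (exists_antilipschitzWith_of_comp (hfactor ▸ h))

theorem exists_forall_antilipschitzWith_sub_smul {T : E →L[𝕜] E} {s : Set 𝕜} (hs : IsCompact s)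
    (h : Disjoint s (approxPointSpectrum T)) :
    ∃ K, ∀ z ∈ s, AntilipschitzWith K (T - z • 1 : E →L[𝕜] E) := by
  have hcont : Continuous fun z : 𝕜 => T - z • (1 : E →L[𝕜] E) := by fun_prop
  obtain ⟨K, hK⟩ := exists_forall_antilipschitzWith_of_isCompact (hs.image hcont) <| by
    rintro _ ⟨z, hz, rfl⟩
    exact notMem_approxPointSpectrum.1 (h.notMem_of_mem_left hz)
  exact ⟨K, fun z hz => hK _ ⟨z, hz, rfl⟩⟩

theorem notMem_approxPointSpectrum_of_isIdempotentElem {P T : E →L[𝕜] E}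
    (hP : IsIdempotentElem P) {a b : ℝ} (hrange : ∀ x, ‖P (T x)‖ ≤ a * ‖P x‖)
    (hker : ∀ x, P x = 0 → b * ‖x‖ ≤ ‖T x‖) {z : 𝕜} (ha : a < ‖z‖) (hb : ‖z‖ < b) :
    z ∉ approxPointSpectrum T := by
  refine notMem_approxPointSpectrum.2 (exists_antilipschitzWith_of_isIdempotentElem hP
    (K₁ := (‖z‖ - a)⁻¹ * ‖P‖) (K₂ := (b - ‖z‖)⁻¹) (fun x => ?_) fun x hx => ?_)
  · rw [mul_assoc, ← div_eq_inv_mul, le_div_iff₀' (sub_pos.2 ha)]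
    calc (‖z‖ - a) * ‖P x‖ ≤ ‖z • P x‖ - ‖P (T x)‖ := by
          rw [norm_smul, sub_mul]; gcongr; exact hrange x
      _ ≤ ‖P ((T - z • 1 : E →L[𝕜] E) x)‖ := by
          simpa [norm_sub_rev] using norm_sub_norm_le (z • P x) (P (T x))
      _ ≤ ‖P‖ * ‖(T - z • 1 : E →L[𝕜] E) x‖ := P.le_opNorm _
  · rw [← div_eq_inv_mul, le_div_iff₀' (sub_pos.2 hb)]
    calc (b - ‖z‖) * ‖x‖ ≤ ‖T x‖ - ‖z • x‖ := by
          rw [norm_smul, sub_mul]; gcongr; exact hker x hx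
      _ ≤ ‖(T - z • 1 : E →L[𝕜] E) x‖ := norm_sub_norm_le _ _

end ApproxPointSpectrum

section MaximumPrinciple

open Metric

variable {E ι : Type*} [NormedAddCommGroup E] [NormedSpace ℂ E] {T : E →L[ℂ] E} {z : ℂ} {ε : ℝ}
  {K : ℝ≥0}

theorem norm_le_of_forall_sphere_norm_sub_smul_le (hε : ε ≠ 0)
    (hT : ∀ w ∈ sphere z ε, AntilipschitzWith K (T - w • 1 : E →L[ℂ] E)) {F : ℂ → E}
    (hF : DiffContOnCl ℂ F (ball z ε)) {δ : ℝ}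
    (h : ∀ w ∈ sphere z ε, ‖T (F w) - w • F w‖ ≤ δ) {w : ℂ} (hw : w ∈ closedBall z ε) :
    ‖F w‖ ≤ K * δ := by
  refine Complex.norm_le_of_forall_mem_frontier_norm_le isBounded_ball hF (fun u hu => ?_)
    (by rwa [closure_ball z hε])
  rw [frontier_ball z hε] at hu
  exact ((T - u • 1).bound_of_antilipschitz (hT u hu) (F u)).trans (by gcongr; exact h u hu)

theorem uniformCauchySeqOn_closedBall_of_sphere (hε : ε ≠ 0)
    (hT : ∀ w ∈ sphere z ε, AntilipschitzWith K (T - w • 1 : E →L[ℂ] E)) {F : ι → ℂ → E}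
    (hF : ∀ i, DiffContOnCl ℂ (F i) (ball z ε)) {l : Filter ι}
    (h : UniformCauchySeqOn (fun i w => T (F i w) - w • F i w) l (sphere z ε)) :
    UniformCauchySeqOn F l (closedBall z ε) := by
  intro u hu
  obtain ⟨η, hη, hηu⟩ := Metric.mem_uniformity_dist.1 hu
  filter_upwards [h _ (dist_mem_uniformity (ε := η / (K + 1)) (by positivity))] with m hm w hw
  have hle : ‖F m.1 w - F m.2 w‖ ≤ K * (η / (K + 1)) := by
    refine norm_le_of_forall_sphere_norm_sub_smul_le hε hT ((hF m.1).sub (hF m.2))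
      (fun v hv => ?_) hw
    calc ‖T ((F m.1 - F m.2) v) - v • (F m.1 - F m.2) v‖
        = dist (T (F m.1 v) - v • F m.1 v) (T (F m.2 v) - v • F m.2 v) := by
          rw [Pi.sub_apply, map_sub, smul_sub, dist_eq_norm, sub_sub_sub_comm]
      _ ≤ η / (K + 1) := (hm v hv).le
  refine hηu ((dist_eq_norm _ _).trans_lt (hle.trans_lt ?_))
  rw [mul_div_assoc', div_lt_iff₀ (by positivity)]
  linarith

theorem exists_analyticOnNhd_ball_of_tendstoUniformlyOn [CompleteSpace E] (hε : ε ≠ 0)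
    (hT : ∀ w ∈ sphere z ε, AntilipschitzWith K (T - w • 1 : E →L[ℂ] E)) {F : ι → ℂ → E}
    (hF : ∀ i, DiffContOnCl ℂ (F i) (ball z ε)) {l : Filter ι} [l.NeBot] {G : ℂ → E}
    (h : TendstoUniformlyOn (fun i w => T (F i w) - w • F i w) G l (closedBall z ε)) :
    ∃ f, AnalyticOnNhd ℂ f (ball z ε) ∧ ∀ w ∈ ball z ε, T (f w) - w • f w = G w := by
  have hcauchy : UniformCauchySeqOn F l (closedBall z ε) :=
    uniformCauchySeqOn_closedBall_of_sphere hε hT hF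
      (h.mono sphere_subset_closedBall).uniformCauchySeqOn
  have hlim : ∀ w ∈ closedBall z ε, ∃ y, Tendsto (F · w) l (𝓝 y) := fun w hw =>
    cauchy_map_iff_exists_tendsto.1 (hcauchy.cauchy_map hw)
  choose! f hf using hlim
  have hloc : TendstoLocallyUniformlyOn F f l (ball z ε) :=
    ((hcauchy.tendstoUniformlyOn_of_tendsto hf).mono
      ball_subset_closedBall).tendstoLocallyUniformlyOn
  refine ⟨f, (hloc.differentiableOn (.of_forall fun i => (hF i).differentiableOn)
    isOpen_ball).analyticOnNhd isOpen_ball, fun w hw => ?_⟩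
  have hw' := ball_subset_closedBall hw
  exact tendsto_nhds_unique
    (((T.continuous.tendsto _).comp (hf w hw')).sub ((hf w hw').const_smul w)) (h.tendsto_at hw')

end MaximumPrinciple

section Bishop

variable {H H' : Type*} [NormedAddCommGroup H] [InnerProductSpace ℂ H] [NormedAddCommGroup H']
  [InnerProductSpace ℂ H'] {T : H →L[ℂ] H} {T' : H' →L[ℂ] H'} {U V : Set ℂ}

/-- `T_U` is injective with closed range: the condition that Bishop's property (β) imposes on each
open set `U`. -/
def HasBishopOn (T : H →L[ℂ] H) (U : Set ℂ) : Prop :=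
  Function.Injective (bishopMap T U) ∧ IsClosed (Set.range (bishopMap T U))

theorem mem_range_bishopMap_iff {g : holo (H := H) U} :
    g ∈ Set.range (bishopMap T U) ↔
      ∃ F : ℂ → H, AnalyticOnNhd ℂ F U ∧ ∀ z : U, T (F z) - (z : ℂ) • F z = g.1 z := by
  constructor
  · rintro ⟨f, rfl⟩
    obtain ⟨F, hF, hfF⟩ := f.2
    exact ⟨F, hF, fun z => by simp [bishopMap, hfF]⟩
  · rintro ⟨F, hF, hFg⟩
    exact ⟨⟨⟨fun z => F z, hF.continuousOn.domRestrict⟩, F, hF, fun _ => rfl⟩,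
      by ext z; exact hFg z⟩

theorem injective_bishopMap_iff :
    Function.Injective (bishopMap T U) ↔
      ∀ F : ℂ → H, AnalyticOnNhd ℂ F U → (∀ z ∈ U, T (F z) - z • F z = 0) → ∀ z ∈ U, F z = 0 := by
  rw [injective_iff_map_eq_zero]
  constructor
  · intro h F hF hF0 z hz
    have := h ⟨⟨fun z => F z, hF.continuousOn.domRestrict⟩, F, hF, fun _ => rfl⟩
      (by ext z; exact hF0 z z.2)
    exact congr($(this).1 ⟨z, hz⟩)
  · intro h f hf
    obtain ⟨F, hF, hfF⟩ := f.2
    ext z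
    rw [hfF]
    refine h F hF (fun w hw => ?_) z z.2
    simpa [bishopMap, hfF] using congr($(hf).1 ⟨w, hw⟩)

/-- The continuous linear map `f ↦ A ∘ f ∘ φ` from `O(U, H)` to `O(V, H')`, for `φ : V → U`
analytic. -/
noncomputable def holoComp (A : H →L[ℂ] H') {φ : ℂ → ℂ} (hφ : AnalyticOnNhd ℂ φ V)
    (hm : Set.MapsTo φ V U) : holo (H := H) U →L[ℂ] holo (H := H') V where
  toFun f := ⟨((⟨A, A.continuous⟩ : C(H, H')).comp f.1).comp
      ⟨hm.restrict, hφ.continuousOn.mapsToRestrict hm⟩,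
    let ⟨F, hF, hfF⟩ := f.2
    ⟨fun z => A (F (φ z)), fun z hz => (A.analyticAt _).comp ((hF _ (hm hz)).comp (hφ z hz)),
      fun z => congrArg A (hfF ⟨φ z, hm z.2⟩)⟩⟩
  map_add' f g := by ext z; exact map_add A _ _
  map_smul' c f := by ext z; exact map_smul A c _
  cont := ((ContinuousMap.continuous_precomp _).comp
    ((ContinuousMap.continuous_postcomp _).comp continuous_subtype_val)).subtype_mk _

theorem holoComp_apply (A : H →L[ℂ] H') {φ : ℂ → ℂ} (hφ : AnalyticOnNhd ℂ φ V)
    (hm : Set.MapsTo φ V U) (f : holo (H := H) U) (z : V) :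
    (holoComp A hφ hm f).1 z = A (f.1 ⟨φ z, hm z.2⟩) := rfl

/-- The restriction map from `O(U, H)` to `O(V, H)`. -/
noncomputable def holoRestrict (hVU : V ⊆ U) : holo (H := H) U →L[ℂ] holo (H := H) V :=
  holoComp (.id ℂ H) analyticOnNhd_id ((Set.mapsTo_id V).mono_right hVU)

theorem holoRestrict_mem_closure_range (hVU : V ⊆ U) {g : holo (H := H) U}
    (hg : g ∈ closure (Set.range (bishopMap T U))) :
    holoRestrict hVU g ∈ closure (Set.range (bishopMap T V)) := by
  refine map_mem_closure (holoRestrict hVU).continuous hg ?_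
  rintro _ ⟨f, rfl⟩
  exact ⟨holoRestrict hVU f, rfl⟩

theorem tendstoUniformlyOn_of_tendsto_holo {ι : Type*} {l : Filter ι} {f : ι → holo (H := H) U}
    {g : holo (H := H) U} (h : Tendsto f l (𝓝 g)) {F : ι → ℂ → H} {G : ℂ → H}
    (hF : ∀ i (z : U), (f i).1 z = F i z) (hG : ∀ z : U, g.1 z = G z) {K : Set ℂ}
    (hK : IsCompact K) (hKU : K ⊆ U) : TendstoUniformlyOn F G l K := by
  have hK' : IsCompact ((↑) ⁻¹' K : Set U) := by
    rwa [Topology.IsInducing.subtypeVal.isCompact_iff, Subtype.image_preimage_coe,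
      Set.inter_eq_right.2 hKU]
  intro u hu
  filter_upwards [ContinuousMap.tendsto_iff_forall_isCompact_tendstoUniformlyOn.1
    ((continuous_subtype_val.tendsto g).comp h) _ hK' u hu] with i hi z hz
  rw [← hG ⟨z, hKU hz⟩, ← hF i ⟨z, hKU hz⟩]
  exact hi ⟨z, hKU hz⟩ hz

theorem mem_range_bishopMap_of_locally
    (hinj : ∀ V ⊆ U, IsOpen V → Function.Injective (bishopMap T V)) {g : holo (H := H) U}
    (hg : ∀ z ∈ U, ∃ V, ∃ hVU : V ⊆ U, IsOpen V ∧ z ∈ V ∧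
      holoRestrict hVU g ∈ Set.range (bishopMap T V)) :
    g ∈ Set.range (bishopMap T U) := by
  simp only [mem_range_bishopMap_iff] at hg
  choose! V hVU hV hzV F hF hFg using hg
  have hagree : ∀ z ∈ U, ∀ w ∈ V z, F z w = F w w := fun z hz w hw => by
    have hwU := hVU z hz hw
    refine sub_eq_zero.1 <| injective_bishopMap_iff.1
      (hinj (V z ∩ V w) (Set.inter_subset_left.trans (hVU z hz)) ((hV z hz).inter (hV w hwU)))
      (F z - F w) (fun u hu => (hF z hz u hu.1).sub (hF w hwU u hu.2)) (fun u hu => ?_)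
      w ⟨hw, hzV w hwU⟩
    rw [Pi.sub_apply, map_sub, smul_sub, sub_sub_sub_comm, hFg z hz ⟨u, hu.1⟩,
      hFg w hwU ⟨u, hu.2⟩]
    exact sub_self (g.1 ⟨u, hVU z hz hu.1⟩)
  refine mem_range_bishopMap_iff.2 ⟨fun w => F w w, fun z hz => ?_, fun z =>
    hFg z z.2 ⟨z, hzV z z.2⟩⟩
  exact (hF z hz z (hzV z hz)).congr
    (((hV z hz).eventually_mem (hzV z hz)).mono fun w hw => hagree z hz w hw)

theorem hasBishopOn_of_forall_hasBishopAt (hU : IsOpen U) (h : ∀ z ∈ U, HasBishopAt T z) :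
    HasBishopOn T U := by
  have hinj : ∀ V ⊆ U, IsOpen V → Function.Injective (bishopMap T V) := by
    refine fun V hVU hV => injective_bishopMap_iff.2 fun F hF hF0 z hz => ?_
    obtain ⟨N, hN, hzN, hβ⟩ := h z (hVU hz)
    exact injective_bishopMap_iff.1 (hβ (V ∩ N) (hV.inter hN) Set.inter_subset_right).1 F
      (hF.mono Set.inter_subset_left) (fun w hw => hF0 w hw.1) z ⟨hz, hzN⟩
  refine ⟨hinj U subset_rfl hU, isClosed_of_closure_subset fun g hg =>
    mem_range_bishopMap_of_locally hinj fun z hz => ?_⟩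
  obtain ⟨N, hN, hzN, hβ⟩ := h z hz
  exact ⟨U ∩ N, Set.inter_subset_left, hU.inter hN, ⟨hz, hzN⟩,
    (hβ (U ∩ N) (hU.inter hN) Set.inter_subset_right).2.closure_subset
      (holoRestrict_mem_closure_range _ hg)⟩

theorem hasBishop_of_sigmaBeta_eq_empty (h : sigmaBeta T = ∅) : HasBishop T := fun _ hU =>
  hasBishopOn_of_forall_hasBishopAt hU fun z _ => not_not.1 (Set.eq_empty_iff_forall_notMem.1 h z)

/-- The isomorphism `f ↦ A ∘ f ∘ (c * ·)` between `O(cU, H)` and `O(U, H')`. -/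
noncomputable def holoCongr (A : H ≃L[ℂ] H') {c : ℂ} (hc : c ≠ 0) (U : Set ℂ) :
    holo (H := H) ((c⁻¹ * ·) ⁻¹' U) ≃L[ℂ] holo (H := H') U :=
  .equivOfInverse
    (holoComp A (φ := (c * ·)) (analyticOnNhd_const.mul analyticOnNhd_id) <|
      Set.mapsTo_iff_subset_preimage.2 <| by simp [Set.preimage_preimage, hc])
    (holoComp A.symm (φ := (c⁻¹ * ·)) (analyticOnNhd_const.mul analyticOnNhd_id)
      (Set.mapsTo_preimage _ _))
    (fun f => by ext z; simp [holoComp_apply, hc]) (fun f => by ext z; simp [holoComp_apply, hc])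

theorem HasBishopOn.conj {c : ℂ} (hc : c ≠ 0) (A : H ≃L[ℂ] H')
    (hA : ∀ x, A (T x) = c • T' (A x)) (h : HasBishopOn T ((c⁻¹ * ·) ⁻¹' U)) :
    HasBishopOn T' U := by
  set Φ := holoCongr A hc U
  have hΨ : Function.Bijective fun f => Φ (c • f) := Φ.bijective.comp (MulAction.bijective₀ hc)
  have hconj : bishopMap T' U ∘ (fun f => Φ (c • f)) = Φ ∘ bishopMap T ((c⁻¹ * ·) ⁻¹' U) := by
    ext f z
    simp [Φ, holoCongr, holoComp_apply, bishopMap, hA, smul_smul, mul_comm]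
  refine ⟨.of_comp_right (hconj ▸ Φ.injective.comp h.1) hΨ.surjective, ?_⟩
  rw [← hΨ.surjective.range_comp, hconj, Set.range_comp]
  exact Φ.toHomeomorph.isClosedMap _ h.2

theorem HasBishopAt.conj {c z : ℂ} (hc : c ≠ 0) (A : H ≃L[ℂ] H')
    (hA : ∀ x, A (T x) = c • T' (A x)) (h : HasBishopAt T (c * z)) : HasBishopAt T' z := by
  obtain ⟨V, hV, hzV, hβ⟩ := h
  refine ⟨(c * ·) ⁻¹' V, hV.preimage (by fun_prop), hzV, fun U hU hUV =>
    HasBishopOn.conj hc A hA (hβ _ (hU.preimage (by fun_prop)) fun z hz => ?_)⟩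
  simpa [hc] using hUV hz

theorem exists_closedBall_subset_of_notMem_derivedSet {z : ℂ}
    (hz : z ∉ derivedSet (approxPointSpectrum T)) {N : Set ℂ} (hN : N ∈ 𝓝 z) :
    ∃ ε > 0, Metric.closedBall z ε ⊆ N ∧
      ∃ K, ∀ w ∈ Metric.sphere z ε, AntilipschitzWith K (T - w • 1 : H →L[ℂ] H) := by
  rw [mem_derivedSet, accPt_iff_frequently_nhdsNE, not_frequently, eventually_nhdsWithin_iff] at hz
  obtain ⟨ε, hε, hball⟩ := Metric.nhds_basis_closedBall.mem_iff.1 (inter_mem hN hz)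
  refine ⟨ε, hε, fun w hw => (hball hw).1, exists_forall_antilipschitzWith_sub_smul
    (isCompact_sphere z ε) (Set.disjoint_left.2 fun w hw => ?_)⟩
  exact (hball (Metric.sphere_subset_closedBall hw)).2 (Metric.ne_of_mem_sphere hw hε.ne')

theorem injective_bishopMap_of_disjoint_derivedSet (hU : IsOpen U)
    (h : Disjoint U (derivedSet (approxPointSpectrum T))) :
    Function.Injective (bishopMap T U) := by
  refine injective_bishopMap_iff.2 fun F hF hF0 z hz => ?_
  obtain ⟨ε, hε, hball, K, hK⟩ :=
    exists_closedBall_subset_of_notMem_derivedSet (h.notMem_of_mem_left hz) (hU.mem_nhds hz)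
  have := norm_le_of_forall_sphere_norm_sub_smul_le hε.ne' hK (δ := 0)
    (hF.differentiableOn.diffContOnCl_ball hball)
    (fun w hw => by rw [hF0 w (hball (Metric.sphere_subset_closedBall hw)), norm_zero])
    (Metric.mem_closedBall_self hε.le)
  simpa using this

variable [CompleteSpace H]

theorem exists_ball_holoRestrict_mem_range {z : ℂ} (hz : z ∉ derivedSet (approxPointSpectrum T))
    (hU : U ∈ 𝓝 z) {g : holo (H := H) U} (hg : g ∈ closure (Set.range (bishopMap T U))) :
    ∃ ε > 0, ∃ hεU : Metric.ball z ε ⊆ U,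
      holoRestrict hεU g ∈ Set.range (bishopMap T (Metric.ball z ε)) := by
  obtain ⟨ε, hε, hball, K, hK⟩ := exists_closedBall_subset_of_notMem_derivedSet hz hU
  choose F hF hfF using fun f : holo (H := H) U => f.2
  have : (comap (bishopMap T U) (𝓝 g)).NeBot :=
    comap_neBot fun t ht => by
      obtain ⟨_, ha, f, rfl⟩ := mem_closure_iff_nhds.1 hg t ht
      exact ⟨f, ha⟩
  have hunif : TendstoUniformlyOn (fun f w => T (F f w) - w • F f w) (F g)
      (comap (bishopMap T U) (𝓝 g)) (Metric.closedBall z ε) :=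
    tendstoUniformlyOn_of_tendsto_holo tendsto_comap (fun f w => by simp [bishopMap, hfF])
      (hfF g) (isCompact_closedBall z ε) hball
  obtain ⟨f, hf, hfg⟩ := exists_analyticOnNhd_ball_of_tendstoUniformlyOn hε.ne' hK
    (fun f => (hF f).differentiableOn.diffContOnCl_ball hball) hunif
  exact ⟨ε, hε, Metric.ball_subset_closedBall.trans hball, mem_range_bishopMap_iff.2
    ⟨f, hf, fun w => (hfg w w.2).trans (hfF g ⟨w, hball (Metric.ball_subset_closedBall w.2)⟩).symm⟩⟩

theorem hasBishopOn_of_disjoint_derivedSet (hU : IsOpen U)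
    (h : Disjoint U (derivedSet (approxPointSpectrum T))) : HasBishopOn T U := by
  refine ⟨injective_bishopMap_of_disjoint_derivedSet hU h, isClosed_of_closure_subset fun g hg =>
    mem_range_bishopMap_of_locally
      (fun V hVU hV => injective_bishopMap_of_disjoint_derivedSet hV (h.mono_left hVU))
      fun z hz => ?_⟩
  obtain ⟨ε, hε, hεU, hgε⟩ :=
    exists_ball_holoRestrict_mem_range (h.notMem_of_mem_left hz) (hU.mem_nhds hz) hg
  exact ⟨_, hεU, Metric.isOpen_ball, Metric.mem_ball_self hε, hgε⟩

theorem sigmaBeta_subset_derivedSet_approxPointSpectrum (T : H →L[ℂ] H) :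
    sigmaBeta T ⊆ derivedSet (approxPointSpectrum T) := fun _ hz => not_not.1 fun hz' =>
  hz ⟨_, (isClosed_derivedSet _).isOpen_compl, hz', fun _ hU hUV =>
    hasBishopOn_of_disjoint_derivedSet hU (Set.subset_compl_iff_disjoint_right.1 hUV)⟩

end Bishop

section HilbertBasis

variable {ι ι' 𝕜 E E' F : Type*} [RCLike 𝕜] [NormedAddCommGroup E] [InnerProductSpace 𝕜 E]
  [NormedAddCommGroup E'] [InnerProductSpace 𝕜 E'] [NormedAddCommGroup F] [NormedSpace 𝕜 F]

theorem hasSum_sq_norm_inner (e : HilbertBasis ι 𝕜 E) (x : E) :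
    HasSum (fun i => ‖⟪e i, x⟫_𝕜‖ ^ 2) (‖x‖ ^ 2) := by
  simpa [e.repr_apply_apply] using lp.hasSum_norm (p := 2) (by simp) (e.repr x)

theorem norm_le_of_forall_norm_inner_le {e : HilbertBasis ι 𝕜 E} {f : HilbertBasis ι' 𝕜 E'}
    (σ : ι ≃ ι') {C : ℝ} (hC : 0 ≤ C) {x : E} {y : E'}
    (h : ∀ i, ‖⟪e i, x⟫_𝕜‖ ≤ C * ‖⟪f (σ i), y⟫_𝕜‖) : ‖x‖ ≤ C * ‖y‖ := by
  refine le_of_sq_le_sq ?_ (by positivity)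
  rw [mul_pow]
  refine hasSum_le (fun i => ?_) (hasSum_sq_norm_inner e x)
    (((σ.hasSum_iff).2 (hasSum_sq_norm_inner f y)).mul_left (C ^ 2))
  rw [Function.comp_apply, ← mul_pow]
  gcongr
  exact h i

theorem continuousLinearMap_ext_hilbertBasis (e : HilbertBasis ι 𝕜 E) {A B : E →L[𝕜] F}
    (h : ∀ i, A (e i) = B (e i)) : A = B :=
  ContinuousLinearMap.ext_on
    (Submodule.dense_iff_topologicalClosure_eq_top.2 e.dense_span) (Set.forall_mem_range.2 h)

variable [CompleteSpace E]

theorem exists_linearIsometryEquiv_apply_hilbertBasis_eq_smul (e : HilbertBasis ι 𝕜 E) {c : ι → 𝕜}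
    (hc : ∀ i, ‖c i‖ = 1) : ∃ A : E ≃ₗᵢ[𝕜] E, ∀ i, A (e i) = c i • e i := by
  classical
  have hc0 : ∀ i, c i ≠ 0 := fun i => norm_ne_zero_iff.1 (by simp [hc])
  have hon : Orthonormal 𝕜 fun i => c i • e i :=
    ⟨fun i => by rw [norm_smul, hc, one_mul, e.orthonormal.1], fun i j hij => by
      simp [inner_smul_left, inner_smul_right, e.orthonormal.2 hij]⟩
  have hspan : ⊤ ≤ (Submodule.span 𝕜 (Set.range fun i => c i • e i)).topologicalClosure := by
    rw [← e.dense_span]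
    refine Submodule.topologicalClosure_mono
      (Submodule.span_le.2 (Set.range_subset_iff.2 fun i => ?_))
    rw [← inv_smul_smul₀ (hc0 i) (e i)]
    exact Submodule.smul_mem _ _ (Submodule.subset_span ⟨i, rfl⟩)
  refine ⟨e.repr.trans (HilbertBasis.mk hon hspan).repr.symm, fun i => ?_⟩
  rw [LinearIsometryEquiv.trans_apply, e.repr_self, HilbertBasis.repr_symm_single,
    HilbertBasis.coe_mk]

/-- The orthogonal projection onto the closed span of the basis vectors with index in `s`. -/
noncomputable def coordProjection (e : HilbertBasis ι 𝕜 E) (s : Set ι) : E →L[𝕜] E :=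
  (Submodule.span 𝕜 (e '' s)).closure.toSubmodule.starProjection

theorem isIdempotentElem_coordProjection (e : HilbertBasis ι 𝕜 E) (s : Set ι) :
    IsIdempotentElem (coordProjection e s) :=
  Submodule.isIdempotentElem_starProjection _

theorem inner_coordProjection (e : HilbertBasis ι 𝕜 E) (s : Set ι) (i : ι) (x : E) :
    ⟪e i, coordProjection e s x⟫_𝕜 = s.indicator (fun i => ⟪e i, x⟫_𝕜) i := by
  rw [coordProjection, ← Submodule.inner_starProjection_left_eq_right]
  by_cases hi : i ∈ s
  · rw [Set.indicator_of_mem hi, Submodule.starProjection_eq_self_iff.2]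
    exact Submodule.le_topologicalClosure _ (Submodule.subset_span (Set.mem_image_of_mem e hi))
  · have hortho : Submodule.span 𝕜 {e i} ⟂ Submodule.span 𝕜 (e '' s) := by
      refine Submodule.isOrtho_span.2 ?_
      rintro _ rfl _ ⟨j, hj, rfl⟩
      exact e.orthonormal.2 fun hij => hi (hij ▸ hj)
    rw [Set.indicator_of_notMem hi, (Submodule.starProjection_apply_eq_zero_iff _).2,
      inner_zero_left]
    exact (Submodule.orthogonal_closure _).ge (hortho (Submodule.mem_span_singleton_self _))

end HilbertBasis

section SpectralRadius

variable {H : Type*} [NormedAddCommGroup H] [InnerProductSpace ℂ H] {T : H →L[ℂ] H}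

theorem minModulus_le_norm {z : ℂ} (hz : z ∈ spectrum ℂ T) : minModulus T ≤ ‖z‖ :=
  csInf_le ⟨0, Set.forall_mem_image.2 fun w _ => norm_nonneg w⟩ ⟨z, hz, rfl⟩

theorem minModulus_eq_zero (hT : ¬ IsUnit T) : minModulus T = 0 :=
  le_antisymm (by simpa using minModulus_le_norm ((spectrum.zero_mem_iff ℂ).2 hT))
    (Real.sInf_nonneg (Set.forall_mem_image.2 fun w _ => norm_nonneg w))

variable [CompleteSpace H] [Nontrivial H]

theorem isGreatest_specRadius (T : H →L[ℂ] H) :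
    IsGreatest (norm '' spectrum ℂ T) (specRadius T) := by
  obtain ⟨z, hz, hzr⟩ := spectrum.exists_nnnorm_eq_spectralRadius T
  rw [specRadius, ← hzr]
  refine ⟨⟨z, hz, rfl⟩, Set.forall_mem_image.2 fun w hw => ?_⟩
  have : (‖w‖₊ : ENNReal) ≤ ‖z‖₊ := hzr ▸ le_iSup₂ (α := ENNReal) w hw
  exact_mod_cast this

theorem minModulus_eq_one_div_specRadius_inverse (hT : IsUnit T) :
    minModulus T = 1 / specRadius (Ring.inverse T) := by
  obtain ⟨u, rfl⟩ := hT
  have hinv : ∀ w, w ∈ spectrum ℂ (↑u⁻¹ : H →L[ℂ] H) ↔ w⁻¹ ∈ spectrum ℂ (↑u : H →L[ℂ] H) :=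
    fun w => by rw [← spectrum.map_inv, Set.mem_inv]
  obtain ⟨⟨z, hz, hzr⟩, hmax⟩ := isGreatest_specRadius (↑u⁻¹ : H →L[ℂ] H)
  rw [Ring.inverse_unit, one_div]
  refine IsLeast.csInf_eq
    ⟨⟨z⁻¹, (hinv z).1 hz, by simp [hzr]⟩, Set.forall_mem_image.2 fun w hw => ?_⟩
  have hw0 : w ≠ 0 := fun h => spectrum.zero_notMem ℂ u.isUnit (h ▸ hw)
  exact inv_le_of_inv_le₀ (norm_pos_iff.2 hw0)
    (hmax ⟨w⁻¹, (hinv _).2 (by rwa [inv_inv]), norm_inv w⟩)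

end SpectralRadius

section RootLimits

variable {κ : Type*} {v : ℕ → κ → ℝ} {r c : ℝ}

theorem eventually_le_pow_of_tendsto_iSup (hv : ∀ n k, 0 ≤ v n k)
    (hbdd : ∀ n, BddAbove (Set.range (v n)))
    (h : Tendsto (fun n : ℕ => (⨆ k, v n k) ^ (1 / (n : ℝ))) atTop (𝓝 r)) (hc : r < c) :
    ∀ᶠ n in atTop, ∀ k, v n k ≤ c ^ n := by
  filter_upwards [h.eventually_lt_const hc, eventually_ne_atTop 0] with n hn hn0 k
  have hsup : 0 ≤ ⨆ k, v n k := Real.iSup_nonneg (hv n)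
  calc v n k ≤ ⨆ k, v n k := le_ciSup (hbdd n) k
    _ = ((⨆ k, v n k) ^ (1 / (n : ℝ))) ^ n := by rw [one_div, Real.rpow_inv_natCast_pow hsup hn0]
    _ ≤ c ^ n := by gcongr

theorem eventually_pow_le_of_tendsto_iInf (hv : ∀ n k, 0 ≤ v n k)
    (h : Tendsto (fun n : ℕ => (⨅ k, v n k) ^ (1 / (n : ℝ))) atTop (𝓝 r)) (hc₀ : 0 ≤ c)
    (hc : c < r) : ∀ᶠ n in atTop, ∀ k, c ^ n ≤ v n k := by
  filter_upwards [h.eventually_const_lt hc, eventually_ne_atTop 0] with n hn hn0 k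
  have hinf : 0 ≤ ⨅ k, v n k := Real.iInf_nonneg (hv n)
  calc c ^ n ≤ ((⨅ k, v n k) ^ (1 / (n : ℝ))) ^ n := by gcongr
    _ = ⨅ k, v n k := by rw [one_div, Real.rpow_inv_natCast_pow hinf hn0]
    _ ≤ v n k := ciInf_le ⟨0, Set.forall_mem_range.2 (hv n)⟩ k

end RootLimits

theorem derivedSet_insert_subset {X : Type*} [TopologicalSpace X] [T1Space X] {s : Set X}
    (hs : IsClosed s) (x : X) : derivedSet (insert x s) ⊆ s := by
  rw [Set.insert_eq, derivedSet_union]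
  refine Set.union_subset (fun y hy => ?_) ((isClosed_iff_derivedSet_subset s).1 hs)
  have hyx : y = x := (isClosed_iff_derivedSet_subset {x}).1 isClosed_singleton hy
  rw [mem_derivedSet, accPt_iff_frequently_nhdsNE] at hy
  exact (hy.and_eventually self_mem_nhdsWithin).exists.elim fun z hz =>
    absurd (hz.1.trans hyx.symm) hz.2

section Shift

variable {H : Type*} [NormedAddCommGroup H] [InnerProductSpace ℂ H] {e : HilbertBasis ℤ ℂ H}
  {ω : ℤ → ℝ} {S : H →L[ℂ] H}

theorem beta_div_nonneg (hω : ∀ n, 0 < ω n) (m n : ℤ) : 0 ≤ beta ω m / beta ω n :=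
  div_nonneg (beta_pos hω m).le (beta_pos hω n).le

theorem IsBilateralShift.pow_apply_basis (hS : IsBilateralShift e ω S) (n : ℕ) (m : ℤ) :
    (S ^ n) (e m) = ((beta ω (m + n) / beta ω m : ℝ) : ℂ) • e (m + n) := by
  induction n with
  | zero => simp [(beta_pos hS.pos m).ne']
  | succ n ih =>
    rw [pow_succ', mul_apply_eq_comp, ih, map_smul, hS.apply_basis, smul_smul, Nat.cast_succ,
      ← add_assoc, beta_succ hS.pos, ← Complex.ofReal_mul, div_mul_eq_mul_div]

theorem IsBilateralShift.inner_pow_apply (hS : IsBilateralShift e ω S) (n : ℕ) (m : ℤ) (x : H) :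
    ⟪e (m + n), (S ^ n) x⟫_ℂ = ((beta ω (m + n) / beta ω m : ℝ) : ℂ) * ⟪e m, x⟫_ℂ := by
  have h : (innerSL ℂ (e (m + n))).comp (S ^ n) =
      ((beta ω (m + n) / beta ω m : ℝ) : ℂ) • innerSL ℂ (e m) := by
    refine continuousLinearMap_ext_hilbertBasis e fun k => ?_
    rcases eq_or_ne m k with rfl | hmk
    · simp [hS.pow_apply_basis, e.orthonormal.1]
    · simp [hS.pow_apply_basis, e.orthonormal.2 hmk,
        e.orthonormal.2 (add_left_injective (n : ℤ) |>.ne hmk)]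
  exact congr($h x)

theorem IsBilateralShift.norm_inner_pow_apply (hS : IsBilateralShift e ω S) (n : ℕ) (m : ℤ)
    (x : H) : ‖⟪e (m + n), (S ^ n) x⟫_ℂ‖ = beta ω (m + n) / beta ω m * ‖⟪e m, x⟫_ℂ‖ := by
  rw [hS.inner_pow_apply, norm_mul, Complex.norm_of_nonneg (beta_div_nonneg hS.pos _ _)]

theorem IsBilateralShift.rMinus_nonneg (hS : IsBilateralShift e ω S) : 0 ≤ rMinus ω :=
  ge_of_tendsto' hS.tendsto_rMinus fun _ =>
    Real.rpow_nonneg (Real.iSup_nonneg fun _ => beta_div_nonneg hS.pos _ _) _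

theorem IsBilateralShift.eventually_beta_div_le_pow (hS : IsBilateralShift e ω S) {a : ℝ}
    (ha : rMinus ω < a) :
    ∀ᶠ n : ℕ in atTop, ∀ m : ℤ, m + n < 0 → beta ω (m + n) / beta ω m ≤ a ^ n := by
  obtain ⟨C, hC⟩ := hS.bddAbove
  have hbdd : ∀ n : ℕ, BddAbove (Set.range fun k : ℕ =>
      beta ω (-(k + 1)) / beta ω (-n - (k + 1))) := fun n => by
    refine ⟨C ^ n, Set.forall_mem_range.2 fun k => ?_⟩
    rw [beta_neg_div hS.pos]
    simpa using Finset.prod_le_prod (s := Finset.range n) (fun i _ => (hS.pos _).le)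
      fun i _ => hC ⟨-((k + i : ℕ) : ℤ) - 2, rfl⟩
  filter_upwards [eventually_le_pow_of_tendsto_iSup (fun _ _ => beta_div_nonneg hS.pos _ _) hbdd
    hS.tendsto_rMinus ha] with n hn m hm
  obtain ⟨k, hk⟩ := Int.eq_negSucc_of_lt_zero hm
  rw [Int.negSucc_eq] at hk
  have := hn k
  rwa [← hk, show (-n - (k + 1) : ℤ) = m by lia] at this

theorem IsBilateralShift.eventually_pow_le_beta_div (hS : IsBilateralShift e ω S) {b : ℝ}
    (hb₀ : 0 ≤ b) (hb : b < rPlus₁ ω) :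
    ∀ᶠ n : ℕ in atTop, ∀ m : ℤ, 0 ≤ m → b ^ n ≤ beta ω (m + n) / beta ω m := by
  filter_upwards [eventually_pow_le_of_tendsto_iInf (fun _ _ => beta_div_nonneg hS.pos _ _)
    hS.tendsto_rPlus₁ hb₀ hb] with n hn m hm
  lift m to ℕ using hm
  rw [add_comm]
  exact hn m

variable [CompleteSpace H]

theorem IsBilateralShift.norm_coordProjection_pow_apply_le (hS : IsBilateralShift e ω S) {n : ℕ}
    {a : ℝ} (ha₀ : 0 ≤ a) (ha : ∀ m : ℤ, m + n < 0 → beta ω (m + n) / beta ω m ≤ a) (x : H) :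
    ‖coordProjection e (Set.Iio 0) ((S ^ n) x)‖ ≤ a * ‖coordProjection e (Set.Iio 0) x‖ := by
  refine norm_le_of_forall_norm_inner_le (e := e) (f := e) (Equiv.subRight (n : ℤ)) ha₀ fun i => ?_
  obtain ⟨m, rfl⟩ : ∃ m, i = m + n := ⟨i - n, by ring⟩
  rw [Equiv.subRight_apply, add_sub_cancel_right, inner_coordProjection, inner_coordProjection]
  by_cases hm : m + (n : ℤ) < 0
  · rw [Set.indicator_of_mem (Set.mem_Iio.2 hm), Set.indicator_of_mem (Set.mem_Iio.2 (by lia)),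
      hS.norm_inner_pow_apply]
    gcongr
    exact ha m hm
  · rw [Set.indicator_of_notMem (mt Set.mem_Iio.1 hm), norm_zero]
    positivity

theorem IsBilateralShift.le_norm_pow_apply (hS : IsBilateralShift e ω S) {n : ℕ} {b : ℝ}
    (hb₀ : 0 < b) (hb : ∀ m : ℤ, 0 ≤ m → b ≤ beta ω (m + n) / beta ω m) {x : H}
    (hx : coordProjection e (Set.Iio 0) x = 0) : b * ‖x‖ ≤ ‖(S ^ n) x‖ := by
  rw [← le_div_iff₀' hb₀, div_eq_inv_mul]
  refine norm_le_of_forall_norm_inner_le (e := e) (f := e) (Equiv.addRight (n : ℤ))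
    (inv_nonneg.2 hb₀.le) fun m => ?_
  rw [Equiv.coe_addRight, hS.norm_inner_pow_apply, ← div_eq_inv_mul, le_div_iff₀' hb₀]
  rcases lt_or_ge m 0 with hm | hm
  · have : ⟪e m, x⟫_ℂ = 0 := by
      have h := inner_coordProjection e (Set.Iio 0) m x
      rwa [hx, inner_zero_right, Set.indicator_of_mem (Set.mem_Iio.2 hm), eq_comm] at h
    simp [this]
  · gcongr
    exact hb m hm

theorem IsBilateralShift.notMem_approxPointSpectrum (hS : IsBilateralShift e ω S) {z : ℂ}
    (hz₁ : rMinus ω < ‖z‖) (hz₂ : ‖z‖ < rPlus₁ ω) : z ∉ approxPointSpectrum S := by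
  obtain ⟨a, ha, haz⟩ := exists_between hz₁
  obtain ⟨b, hzb, hb⟩ := exists_between hz₂
  have hb₀ : 0 < b := (norm_nonneg z).trans_lt hzb
  obtain ⟨n, hna, hnb, hn⟩ := ((hS.eventually_beta_div_le_pow ha).and
    ((hS.eventually_pow_le_beta_div hb₀.le hb).and (eventually_ne_atTop 0))).exists
  suffices z ^ n ∉ approxPointSpectrum (S ^ n) from
    fun h => this (pow_mem_approxPointSpectrum_pow h n)
  have ha₀ : 0 ≤ a := hS.rMinus_nonneg.trans ha.le
  refine notMem_approxPointSpectrum_of_isIdempotentElem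
    (isIdempotentElem_coordProjection e (Set.Iio 0))
    (hS.norm_coordProjection_pow_apply_le (pow_nonneg ha₀ n) hna)
    (fun x hx => hS.le_norm_pow_apply (pow_pos hb₀ n) hnb hx) ?_ ?_ <;> rw [norm_pow]
  · exact pow_lt_pow_left₀ haz ha₀ hn
  · exact pow_lt_pow_left₀ hzb (norm_nonneg z) hn

theorem IsBilateralShift.approxPointSpectrum_subset (hS : IsBilateralShift e ω S)
    (hq : rMinus ω ≤ minModulus S) (hr : specRadius S ≤ rPlus₁ ω) :
    approxPointSpectrum S ⊆ norm ⁻¹' {minModulus S, specRadius S} := by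
  have : Nontrivial H := ⟨e 0, 0, e.orthonormal.ne_zero 0⟩
  intro z hz
  have hzS := approxPointSpectrum_subset_spectrum S hz
  by_contra h
  obtain ⟨hzq, hzr⟩ := not_or.1 h
  exact hS.notMem_approxPointSpectrum
    (hq.trans_lt ((minModulus_le_norm hzS).lt_of_ne' hzq))
    ((((isGreatest_specRadius S).2 ⟨z, hzS, rfl⟩).lt_of_ne hzr).trans_le hr) hz

theorem IsBilateralShift.sigmaBeta_subset (hS : IsBilateralShift e ω S)
    (hq : rMinus ω ≤ minModulus S) (hr : specRadius S ≤ rPlus₁ ω) :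
    sigmaBeta S ⊆ norm ⁻¹' {minModulus S, specRadius S} :=
  calc sigmaBeta S ⊆ derivedSet (approxPointSpectrum S) :=
        sigmaBeta_subset_derivedSet_approxPointSpectrum S
    _ ⊆ derivedSet (norm ⁻¹' {minModulus S, specRadius S}) :=
        derivedSet_mono _ _ (hS.approxPointSpectrum_subset hq hr)
    _ ⊆ norm ⁻¹' {minModulus S, specRadius S} :=
        isClosed_iff_derivedSet_subset _ |>.1
          ((Set.toFinite {minModulus S, specRadius S}).isClosed.preimage continuous_norm)

theorem IsBilateralShift.sigmaBeta_subset_of_not_isUnit (hS : IsBilateralShift e ω S)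
    (hq : rMinus ω ≤ minModulus S) (hr : specRadius S ≤ rPlus₁ ω) (hu : ¬ IsUnit S) :
    sigmaBeta S ⊆ norm ⁻¹' {specRadius S} := by
  have hσ : approxPointSpectrum S ⊆ insert 0 (norm ⁻¹' {specRadius S}) := by
    simpa [Set.subset_def, minModulus_eq_zero hu] using hS.approxPointSpectrum_subset hq hr
  exact (sigmaBeta_subset_derivedSet_approxPointSpectrum S).trans <|
    (derivedSet_mono _ _ hσ).trans <|
      derivedSet_insert_subset (isClosed_singleton.preimage continuous_norm) 0

theorem IsBilateralShift.exists_rotation (hS : IsBilateralShift e ω S) {c : ℂ} (hc : ‖c‖ = 1) :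
    ∃ A : H ≃ₗᵢ[ℂ] H, ∀ x, A (S x) = c • S (A x) := by
  have hc0 : c ≠ 0 := norm_ne_zero_iff.1 (by simp [hc])
  obtain ⟨A, hA⟩ := exists_linearIsometryEquiv_apply_hilbertBasis_eq_smul e (c := fun n => c ^ n)
    (fun n => by simp [norm_zpow, hc])
  have h : (A.toContinuousLinearEquiv : H →L[ℂ] H) * S =
      c • (S * (A.toContinuousLinearEquiv : H →L[ℂ] H)) :=
    continuousLinearMap_ext_hilbertBasis e fun n => by
      change A (S (e n)) = c • S (A (e n))
      rw [hS.apply_basis, map_smul, hA, hA, map_smul, hS.apply_basis, smul_smul, smul_smul,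
        smul_smul, zpow_add_one₀ hc0]
      ring_nf
  exact ⟨A, fun x => congr($h x)⟩

theorem IsBilateralShift.mem_sigmaBeta_of_norm_eq (hS : IsBilateralShift e ω S) {z w : ℂ}
    (hzw : ‖z‖ = ‖w‖) (hz : z ∈ sigmaBeta S) : w ∈ sigmaBeta S := by
  rcases eq_or_ne z 0 with rfl | hz0
  · rwa [norm_eq_zero.1 (hzw.symm.trans norm_zero)]
  have hc : ‖w / z‖ = 1 := by rw [norm_div, hzw, div_self (by simpa [← hzw] using hz0)]
  obtain ⟨A, hA⟩ := hS.exists_rotation hc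
  have hc0 : w / z ≠ 0 := norm_ne_zero_iff.1 (hc ▸ one_ne_zero)
  refine fun hw => hz (HasBishopAt.conj hc0 A.toContinuousLinearEquiv hA ?_)
  rwa [div_mul_cancel₀ _ hz0]

theorem IsBilateralShift.preimage_image_norm_sigmaBeta (hS : IsBilateralShift e ω S) :
    norm ⁻¹' (norm '' sigmaBeta S) = sigmaBeta S :=
  Set.Subset.antisymm (fun _ ⟨_, hz, hzw⟩ => hS.mem_sigmaBeta_of_norm_eq hzw hz)
    (Set.subset_preimage_image _ _)

end Shift

end WeightedShift

open WeightedShift in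
theorem mainTheorem7 {H : Type*} [NormedAddCommGroup H] [InnerProductSpace ℂ H] [CompleteSpace H]
    (e : HilbertBasis ℤ ℂ H) (ω : ℤ → ℝ) (S : H →L[ℂ] H) (hS : IsBilateralShift e ω S)
    (hqs1 : minModulus S = rMinus₁ ω ∧ rMinus₁ ω = rMinus₂ ω ∧ rMinus₂ ω = rMinus₃ ω ∧
      rMinus₃ ω = rMinus ω)
    (hqs2 : rPlus₁ ω = rPlus₂ ω ∧ rPlus₂ ω = rPlus₃ ω ∧ rPlus₃ ω = rPlus ω ∧
      rPlus ω = specRadius S) :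
    (¬ IsUnit S → HasBishop S ∨ sigmaBeta S = {z : ℂ | ‖z‖ = specRadius S}) ∧
    (IsUnit S → HasBishop S ∨
      sigmaBeta S = {z : ℂ | ‖z‖ = 1 / specRadius (Ring.inverse S)} ∨
      sigmaBeta S = {z : ℂ | ‖z‖ = specRadius S} ∨
      sigmaBeta S = {z : ℂ | ‖z‖ = 1 / specRadius (Ring.inverse S)} ∪
        {z : ℂ | ‖z‖ = specRadius S}) := by
  have hq : minModulus S = rMinus ω :=
    hqs1.1.trans (hqs1.2.1.trans (hqs1.2.2.1.trans hqs1.2.2.2))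
  have hr : rPlus₁ ω = specRadius S :=
    hqs2.1.trans (hqs2.2.1.trans (hqs2.2.2.1.trans hqs2.2.2.2))
  have : Nontrivial H := ⟨e 0, 0, e.orthonormal.ne_zero 0⟩
  have hempty (h : norm '' sigmaBeta S = ∅) : HasBishop S :=
    hasBishop_of_sigmaBeta_eq_empty (Set.image_eq_empty.1 h)
  have hcircles {t : Set ℝ} (h : norm '' sigmaBeta S = t) : sigmaBeta S = norm ⁻¹' t :=
    h ▸ hS.preimage_image_norm_sigmaBeta.symm
  constructor <;> intro hu
  · have hsub := hS.sigmaBeta_subset_of_not_isUnit hq.ge hr.ge hu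
    exact (Set.subset_singleton_iff_eq.1 (Set.image_subset_iff.2 hsub)).imp hempty hcircles
  · have hsub := hS.sigmaBeta_subset hq.ge hr.ge
    rw [← minModulus_eq_one_div_specRadius_inverse hu]
    exact (Set.subset_pair_iff_eq.1 (Set.image_subset_iff.2 hsub)).imp hempty
      (Or.imp hcircles (Or.imp hcircles hcircles))
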